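/- Let $\mathcal H,\mathcal H'$ be complex Hilbert spaces (of arbitrary, possibly infinite, dimension). A \emph{state} $\rho$ on a Hilbert space is a positive trace-class operator of trace one. For bounded observables (bounded self-adjoint operators) $u,v$ put $$\langle u,v\rangle_\rho=\operatorname{tr}\big[(u\circ v)\rho\big],\qquad u\circ v=\tfrac12(uv+vu),\qquad \|u\|_\rho=\sqrt{\langle u,u\rangle_\rho},$$ and let $L_2(\rho)$ be the real Hilbert space obtained as the completion of the bounded observables with respect to $\|\cdot\|_\rho$. Let $\mathcal R\subseteq\mathbb R$ be an open interval and $\theta_0\in\mathcal R$ the true parameter value. A model of states $\{\sigma_\theta:\theta\in\mathcal R\}$ is \emph{regular} (at $\theta_0$) if $\theta\mapsto\sigma_\theta$ is differentiable at $\theta_0$ in the Banach space of self-adjoint trace-class operators with the trace norm, with derivative $\dot\sigma$, and there is a constant $C$ such that $|\operatorname{tr}(u\dot\sigma)|\le C\|u\|_{\sigma_{\theta_0}}$ for all bounded observables $u$. The functional $u\mapsto\operatorname{tr}(u\dot\sigma)$ then extends continuously to $L_2(\sigma_{\theta_0})$, and the \emph{score} is the element $S^\sigma\in L_2(\sigma_{\theta_0})$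 with $\operatorname{tr}(u\dot\sigma)=\langle u,S^\sigma\rangle_{\sigma_{\theta_0}}$ for all $u\in L_2(\sigma_{\theta_0})$; $\|S^\sigma\|^2_{\sigma_{\theta_0}}$ is the Helstrom information. \textbf{Lemma.} Let $\{\omega_\theta:\theta\in\mathcal R\}$ be a regular model of states on $\mathcal H\otimes\mathcal H'$, and let $\tau_\theta=\operatorname{tr}'\omega_\theta$ be its partial trace over $\mathcal H'$, i.e. the unique state on $\mathcal H$ with $\operatorname{tr}(u\tau_\theta)=\operatorname{tr}[(u\otimes I)\omega_\theta]$ for all bounded operators $u$ on $\mathcal H$. Then $\{\tau_\theta:\theta\in\mathcal R\}$ is also regular. Both models have a unique score, and if $S$ is the score of $\{\omega_\theta\}$ at $\omega=\omega_{\theta_0}$ and $\operatorname{tr}'_*S$ is the score of $\{\tau_\theta\}$ at $\operatorname{tr}'\omega=\tau_{\theta_0}$, then $$\|\operatorname{tr}'_*S\|^2_{\operatorname{tr}'\omega}\le\|S\|^2_\omega .$$ -/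

import Mathlib

open scoped InnerProductSpace TensorProduct ENNReal Topology

namespace QModel

noncomputable section

set_option linter.unusedSectionVars false

section Trace

variable {H : Type*} [NormedAddCommGroup H] [InnerProductSpace ℂ H] [CompleteSpace H]

/-- The index set of a fixed orthonormal (Hilbert) basis of `H`. -/
def basisIndex (H : Type*) [NormedAddCommGroup H] [InnerProductSpace ℂ H] [CompleteSpace H] :
    Set H :=
  (exists_hilbertBasis ℂ H).choose

/-- A fixed orthonormal (Hilbert) basis of `H`. -/
def hilbBasis (H : Type*) [NormedAddCommGroup H] [InnerProductSpace ℂ H] [CompleteSpace H] :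
    HilbertBasis (basisIndex H) ℂ H :=
  (exists_hilbertBasis ℂ H).choose_spec.choose

/-- The trace norm `‖T‖₁ = tr |T|`, with `|T| = (T† T)^{1/2}`, as an extended nonnegative real. -/
def traceNorm (T : H →L[ℂ] H) : ℝ≥0∞ :=
  ∑' i, ENNReal.ofReal (⟪hilbBasis H i, CFC.abs T (hilbBasis H i)⟫_ℂ).re

/-- `T` is trace-class when `tr |T| < ∞`. -/
def IsTraceClass (T : H →L[ℂ] H) : Prop := traceNorm T < ∞

/-- The trace `∑ᵢ ⟨eᵢ, T eᵢ⟩`; it is only used for trace-class `T`. -/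
def opTrace (T : H →L[ℂ] H) : ℂ := ∑' i, ⟪hilbBasis H i, T (hilbBasis H i)⟫_ℂ

/-- States (density operators): positive trace-class operators of unit trace. -/
structure QState (H : Type*) [NormedAddCommGroup H] [InnerProductSpace ℂ H] [CompleteSpace H] where
  op : H →L[ℂ] H
  isPositive : op.IsPositive
  isTraceClass : IsTraceClass op
  trace_eq_one : opTrace op = 1

theorem re_inner_self_eq (x : H) : (⟪x, x⟫_ℂ).re = ‖x‖ ^ 2 :=
  inner_self_eq_norm_sq (𝕜 := ℂ) x

theorem hasSum_inner_right {ι : Type*} {f : ι → H} {y : H} (x : H) (h : HasSum f y) :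
    HasSum (fun i => ⟪x, f i⟫_ℂ) ⟪x, y⟫_ℂ :=
  (innerSL ℂ x).hasSum h

theorem hasSum_norm_inner_sq {κ : Type*} (e : HilbertBasis κ ℂ H) (x : H) :
    HasSum (fun k => ‖⟪e k, x⟫_ℂ‖ ^ 2) (‖x‖ ^ 2) := by
  have h := e.hasSum_inner_mul_inner x x
  have h2 := Complex.hasSum_re h
  convert h2 using 1
  · funext k
    rw [← inner_conj_symm x (e k), ← Complex.normSq_eq_conj_mul_self, Complex.ofReal_re,
      Complex.normSq_eq_norm_sq]
  · exact (re_inner_self_eq x).symm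

/-- If `T = ∑ᵢ |vᵢ⟩⟨vᵢ|` with `∑ᵢ ‖vᵢ‖² < ∞`, then `tr (A T) = ∑ᵢ ⟨vᵢ, A vᵢ⟩`. -/
theorem hasSum_inner_of_decomp {ι κ : Type*} (v : ι → H) (hv : Summable fun i => ‖v i‖ ^ 2)
    (T : H →L[ℂ] H) (hT : ∀ x, HasSum (fun i => ⟪v i, x⟫_ℂ • v i) (T x)) (A : H →L[ℂ] H)
    (e : HilbertBasis κ ℂ H) :
    Summable (fun i => ⟪v i, A (v i)⟫_ℂ) ∧
      HasSum (fun k => ⟪e k, A (T (e k))⟫_ℂ) (∑' i, ⟪v i, A (v i)⟫_ℂ) := by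
  let f : ι × κ → ℂ := fun p => ⟪v p.1, e p.2⟫_ℂ * ⟪e p.2, A (v p.1)⟫_ℂ
  let g : ι × κ → ℝ := fun p => ‖⟪e p.2, v p.1⟫_ℂ‖ ^ 2 + ‖⟪e p.2, A (v p.1)⟫_ℂ‖ ^ 2
  have hgi : ∀ i, HasSum (fun k => g (i, k)) (‖v i‖ ^ 2 + ‖A (v i)‖ ^ 2) := fun i =>
    (hasSum_norm_inner_sq e (v i)).add (hasSum_norm_inner_sq e (A (v i)))
  have hg : Summable g := by
    rw [summable_prod_of_nonneg (fun p => by positivity)]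
    refine ⟨fun i => (hgi i).summable, ?_⟩
    simp only [fun i => (hgi i).tsum_eq]
    refine Summable.of_nonneg_of_le (fun i => by positivity) (fun i => ?_)
      (hv.mul_left (1 + ‖A‖ ^ 2))
    have : ‖A (v i)‖ ^ 2 ≤ (‖A‖ * ‖v i‖) ^ 2 := by
      gcongr
      exact A.le_opNorm _
    nlinarith
  have hf : Summable f := by
    refine Summable.of_norm_bounded hg (fun p => ?_)
    simp only [f, g, norm_mul]
    rw [norm_inner_symm (v p.1)]
    nlinarith [sq_nonneg (‖⟪e p.2, v p.1⟫_ℂ‖ - ‖⟪e p.2, A (v p.1)⟫_ℂ‖),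
      sq_nonneg (‖⟪e p.2, v p.1⟫_ℂ‖ + ‖⟪e p.2, A (v p.1)⟫_ℂ‖)]
  have hfi : ∀ i, HasSum (fun k => f (i, k)) ⟪v i, A (v i)⟫_ℂ := fun i =>
    e.hasSum_inner_mul_inner (v i) (A (v i))
  have h1 : HasSum (fun i => ⟪v i, A (v i)⟫_ℂ) (∑' p, f p) := hf.hasSum.prod_fiberwise hfi
  have hfk : ∀ k, HasSum (fun i => f (i, k)) ⟪e k, A (T (e k))⟫_ℂ := by
    intro k
    have h := hasSum_inner_right (e k) (A.hasSum (hT (e k)))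
    refine h.congr_fun fun i => ?_
    simp only [f, map_smul, inner_smul_right]
  have hf' := (Equiv.prodComm κ ι).hasSum_iff.2 hf.hasSum
  have h2 : HasSum (fun k => ⟪e k, A (T (e k))⟫_ℂ) (∑' p, f p) := hf'.prod_fiberwise hfk
  refine ⟨h1.summable, ?_⟩
  rw [h1.tsum_eq]
  exact h2

theorem trace_mul_of_decomp {ι : Type*} (v : ι → H) (hv : Summable fun i => ‖v i‖ ^ 2)
    (T : H →L[ℂ] H) (hT : ∀ x, HasSum (fun i => ⟪v i, x⟫_ℂ • v i) (T x)) (A : H →L[ℂ] H) :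
    opTrace (A * T) = ∑' i, ⟪v i, A (v i)⟫_ℂ :=
  (hasSum_inner_of_decomp v hv T hT A (hilbBasis H)).2.tsum_eq

theorem traceNorm_of_isPositive {T : H →L[ℂ] H} (hT : T.IsPositive) :
    traceNorm T = ∑' i, ENNReal.ofReal (⟪hilbBasis H i, T (hilbBasis H i)⟫_ℂ).re := by
  rw [traceNorm, CFC.abs_of_nonneg T ((ContinuousLinearMap.nonneg_iff_isPositive T).2 hT)]

/-- A positive trace-class operator is `∑ᵢ |vᵢ⟩⟨vᵢ|` with `∑ᵢ ‖vᵢ‖² < ∞`. -/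
theorem exists_decomp {T : H →L[ℂ] H} (hT : T.IsPositive) (hT' : IsTraceClass T) :
    ∃ v : basisIndex H → H, (Summable fun i => ‖v i‖ ^ 2) ∧
      ∀ x, HasSum (fun i => ⟪v i, x⟫_ℂ • v i) (T x) := by
  have h0 : 0 ≤ T := (ContinuousLinearMap.nonneg_iff_isPositive T).2 hT
  let r : H →L[ℂ] H := CFC.sqrt T
  have hr : r * r = T := CFC.sqrt_mul_sqrt_self T h0
  have hrs : r.IsPositive :=
    (ContinuousLinearMap.nonneg_iff_isPositive r).1 (CFC.sqrt_nonneg T)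
  have hsymm : ∀ x y, ⟪r x, y⟫_ℂ = ⟪x, r y⟫_ℂ := fun x y => hrs.isSymmetric x y
  have hrT : ∀ x, r (r x) = T x := fun x => by rw [← hr]; rfl
  refine ⟨fun i => r (hilbBasis H i), ?_, fun x => ?_⟩
  · have hlt := hT'
    rw [IsTraceClass, traceNorm_of_isPositive hT] at hlt
    have hs := ENNReal.summable_toReal hlt.ne
    convert hs using 1
    funext i
    rw [← hrT, ← hsymm, re_inner_self_eq, ENNReal.toReal_ofReal (by positivity)]
  · have h := r.hasSum ((hilbBasis H).hasSum_repr (r x))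
    rw [hrT] at h
    convert h using 1
    funext i
    simp [hsymm, HilbertBasis.repr_apply_apply]

/-- Every square-summable family `v` defines a positive trace-class operator `∑ᵢ |vᵢ⟩⟨vᵢ|`. -/
theorem exists_of_decomp {ι : Type*} (v : ι → H) (hv : Summable fun i => ‖v i‖ ^ 2) :
    ∃ T : H →L[ℂ] H, T.IsPositive ∧ IsTraceClass T ∧
      ∀ x, HasSum (fun i => ⟪v i, x⟫_ℂ • v i) (T x) := by
  have hs : Summable fun i => InnerProductSpace.rankOne ℂ (v i) (v i) := by
    refine Summable.of_norm ?_
    simpa [sq] using hv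
  let T : H →L[ℂ] H := ∑' i, InnerProductSpace.rankOne ℂ (v i) (v i)
  have hT : ∀ x, HasSum (fun i => ⟪v i, x⟫_ℂ • v i) (T x) := by
    intro x
    have h := (ContinuousLinearMap.apply ℂ H x).hasSum hs.hasSum
    exact h
  have hpos : T.IsPositive := by
    rw [ContinuousLinearMap.isPositive_iff_complex]
    intro x
    have h := hasSum_inner_right x (hT x)
    have h' : HasSum (fun i => ((‖⟪v i, x⟫_ℂ‖ ^ 2 : ℝ) : ℂ)) ⟪x, T x⟫_ℂ := by
      refine h.congr_fun fun i => ?_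
      simp only [inner_smul_right]
      rw [← inner_conj_symm x (v i), mul_comm, ← Complex.normSq_eq_conj_mul_self,
        Complex.normSq_eq_norm_sq]
    have h'' := Complex.hasSum_iff _ _ |>.1 h'
    have him : (⟪x, T x⟫_ℂ).im = 0 := by
      refine h''.2.unique ?_
      simp only [Complex.ofReal_im]
      exact hasSum_zero
    have hre : 0 ≤ (⟪x, T x⟫_ℂ).re := by
      refine h''.1.nonneg fun i => ?_
      rw [Complex.ofReal_re]
      positivity
    have hx : ⟪T x, x⟫_ℂ = ⟪x, T x⟫_ℂ := by
      rw [← inner_conj_symm]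
      exact Complex.conj_eq_iff_im.2 him
    rw [hx]
    exact ⟨Complex.ext (by simp) (by simp [him]), hre⟩
  refine ⟨T, hpos, ?_, hT⟩
  rw [IsTraceClass, traceNorm_of_isPositive hpos]
  have h := (hasSum_inner_of_decomp v hv T hT 1 (hilbBasis H)).2.summable
  have h2 := (Complex.hasSum_re h.hasSum).summable
  have h3 := h2.tsum_ofReal_lt_top
  simpa using h3

theorem QState.summable_trace (ρ : QState H) (A : H →L[ℂ] H) :
    Summable fun i => ⟪hilbBasis H i, (A * ρ.op) (hilbBasis H i)⟫_ℂ := by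
  obtain ⟨v, hv, hT⟩ := exists_decomp ρ.isPositive ρ.isTraceClass
  exact (hasSum_inner_of_decomp v hv _ hT A (hilbBasis H)).2.summable

theorem QState.trace_add_mul (ρ : QState H) (A B : H →L[ℂ] H) :
    opTrace ((A + B) * ρ.op) = opTrace (A * ρ.op) + opTrace (B * ρ.op) := by
  rw [opTrace, opTrace, opTrace, ← (ρ.summable_trace A).tsum_add (ρ.summable_trace B)]
  exact tsum_congr fun i => by simp [add_mul]

theorem trace_smul (c : ℂ) (A : H →L[ℂ] H) : opTrace (c • A) = c * opTrace A := by
  rw [opTrace, opTrace, ← tsum_mul_left]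
  exact tsum_congr fun i => by simp

end Trace

section WeightedL2

variable {H : Type*} [NormedAddCommGroup H] [InnerProductSpace ℂ H] [CompleteSpace H]

/-- The Jordan product `u ∘ v = (u v + v u) / 2`. -/
def jordan (u v : H →L[ℂ] H) : H →L[ℂ] H := (1 / 2 : ℂ) • (u * v + v * u)

/-- The real vector space of bounded observables (bounded self-adjoint operators), to be equipped
with the seminorm weighted by the state `ρ`. -/
def Obs (_ρ : QState H) : Type _ := selfAdjoint (H →L[ℂ] H)

instance (ρ : QState H) : AddCommGroup (Obs ρ) :=
  inferInstanceAs (AddCommGroup (selfAdjoint (H →L[ℂ] H)))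

instance (ρ : QState H) : Module ℝ (Obs ρ) :=
  inferInstanceAs (Module ℝ (selfAdjoint (H →L[ℂ] H)))

/-- The bounded operator underlying a bounded observable. -/
def Obs.op {ρ : QState H} (u : Obs ρ) : H →L[ℂ] H := Subtype.val u

theorem Obs.isSelfAdjoint {ρ : QState H} (u : Obs ρ) : IsSelfAdjoint u.op := Subtype.property u

theorem jordan_self_nonneg (ρ : QState H) (u : Obs ρ) :
    0 ≤ (opTrace (jordan u.op u.op * ρ.op)).re := by
  obtain ⟨v, hv, hT⟩ := exists_decomp ρ.isPositive ρ.isTraceClass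
  have hj : jordan u.op u.op = u.op * u.op := by
    rw [jordan, ← two_smul ℂ, smul_smul]
    norm_num
  rw [hj, trace_mul_of_decomp v hv _ hT]
  have hs := (hasSum_inner_of_decomp v hv _ hT (u.op * u.op) (hilbBasis H)).1
  refine (Complex.hasSum_re hs.hasSum).nonneg fun i => ?_
  have h : ⟪v i, (u.op * u.op) (v i)⟫_ℂ = ⟪u.op (v i), u.op (v i)⟫_ℂ :=
    (u.isSelfAdjoint.isSymmetric (v i) (u.op (v i))).symm
  rw [h, re_inner_self_eq]
  positivity

/-- The weighted form `⟨u, v⟩_ρ = tr ((u ∘ v) ρ)` (a real number) on bounded observables is a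
positive semidefinite real inner product. -/
@[reducible] def Obs.core (ρ : QState H) : PreInnerProductSpace.Core ℝ (Obs ρ) where
  inner u v := (opTrace (jordan u.op v.op * ρ.op)).re
  conj_inner_symm u v := by
    simp only [jordan, conj_trivial]
    rw [add_comm]
  re_inner_nonneg u := by simpa using jordan_self_nonneg ρ u
  add_left u v w := by
    have h : jordan (u + v).op w.op = jordan u.op w.op + jordan v.op w.op := by
      have : (u + v).op = u.op + v.op := rfl
      rw [jordan, jordan, jordan, this, ← smul_add]
      congr 1
      rw [add_mul, mul_add]
      abel
    rw [h, ρ.trace_add_mul, Complex.add_re]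
  smul_left u v r := by
    have h : jordan (r • u).op v.op * ρ.op = (r : ℂ) • (jordan u.op v.op * ρ.op) := by
      have : (r • u).op = (r : ℂ) • u.op := by
        ext x
        change r • (u.op x) = (r : ℂ) • u.op x
        simp
      rw [jordan, jordan, this]
      simp only [smul_mul_assoc, mul_smul_comm, ← smul_add, smul_comm (r : ℂ)]
    rw [h, trace_smul]
    simp

instance (ρ : QState H) : SeminormedAddCommGroup (Obs ρ) :=
  @InnerProductSpace.Core.toSeminormedAddCommGroup ℝ (Obs ρ) _ _ _ (Obs.core ρ)

instance (ρ : QState H) : InnerProductSpace ℝ (Obs ρ) := InnerProductSpace.ofCore (Obs.core ρ)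

/-- The real Hilbert space `L₂(ρ)`: the (Hausdorff) completion of the bounded observables in the
seminorm `‖u‖_ρ = ⟨u, u⟩_ρ^{1/2}`. -/
abbrev L2 (ρ : QState H) : Type _ := UniformSpace.Completion (Obs ρ)

end WeightedL2

section Models

variable {H : Type*} [NormedAddCommGroup H] [InnerProductSpace ℂ H] [CompleteSpace H]

/-- The one-parameter model `θ ↦ σ θ`, `θ ∈ R`, is (Fréchet) differentiable at `θ₀` in the Banach
space of self-adjoint trace-class operators, with derivative `D`. -/
def HasTraceDeriv {R : Set ℝ} (σ : R → QState H) (θ₀ : R) (D : H →L[ℂ] H) : Prop :=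
  IsSelfAdjoint D ∧ IsTraceClass D ∧
    Filter.Tendsto (fun θ : R =>
        traceNorm ((σ θ).op - (σ θ₀).op - ((θ : ℝ) - (θ₀ : ℝ)) • D) /
          ENNReal.ofReal |(θ : ℝ) - (θ₀ : ℝ)|)
      (𝓝[≠] θ₀) (𝓝 0)

/-- The model is regular at the true parameter value `θ₀`: it is differentiable there with
derivative `D`, and `|tr (u D)| ≤ C ‖u‖_ρ` for all bounded observables `u`, where `ρ = σ θ₀`. -/
def IsRegularAt {R : Set ℝ} (σ : R → QState H) (θ₀ : R) : Prop :=
  ∃ D : H →L[ℂ] H, HasTraceDeriv σ θ₀ D ∧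
    ∃ C : ℝ, ∀ u : Obs (σ θ₀), ‖opTrace (u.op * D)‖ ≤ C * ‖u‖

/-- `S ∈ L₂(ρ)`, `ρ = σ θ₀`, is a score of the model at `θ₀`: with `D` the derivative at `θ₀`, the
functional `u ↦ tr (u D)` on bounded observables extends continuously to `L₂(ρ)`, and the extension
is `u ↦ ⟨u, S⟩_ρ`. -/
def IsScore {R : Set ℝ} (σ : R → QState H) (θ₀ : R) (S : L2 (σ θ₀)) : Prop :=
  ∃ D : H →L[ℂ] H, HasTraceDeriv σ θ₀ D ∧
    ∃ l : L2 (σ θ₀) →L[ℝ] ℝ,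
      (∀ u : Obs (σ θ₀), opTrace (u.op * D) = ((l (u : L2 (σ θ₀)) : ℝ) : ℂ)) ∧
      ∀ X : L2 (σ θ₀), l X = ⟪X, S⟫_ℝ

end Models

section PartialTrace

variable {H H' : Type*} [NormedAddCommGroup H] [InnerProductSpace ℂ H] [CompleteSpace H]
  [NormedAddCommGroup H'] [InnerProductSpace ℂ H'] [CompleteSpace H']

/-- The Hilbert space tensor product. -/
abbrev HTensor (H H' : Type*) [NormedAddCommGroup H] [InnerProductSpace ℂ H]
    [NormedAddCommGroup H'] [InnerProductSpace ℂ H'] : Type _ :=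
  UniformSpace.Completion (H ⊗[ℂ] H')

/-- The bounded operator `u ⊗ I` on the Hilbert space tensor product. -/
def tensorId (H' : Type*) [NormedAddCommGroup H'] [InnerProductSpace ℂ H'] (u : H →L[ℂ] H) :
    HTensor H H' →L[ℂ] HTensor H H' :=
  (u.rTensor H').completion

/-- `τ` is the partial trace of `ω` over `H'`: `tr (u τ) = tr ((u ⊗ I) ω)` for all bounded `u`. -/
def IsPartialTrace (ω : QState (HTensor H H')) (τ : QState H) : Prop :=
  ∀ u : H →L[ℂ] H, opTrace (u * τ.op) = opTrace (tensorId H' u * ω.op)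

/-- The bounded linear map `x ↦ x ⊗ y`. -/
def tmulRight (H : Type*) [NormedAddCommGroup H] [InnerProductSpace ℂ H] (y : H') :
    H →L[ℂ] HTensor H H' :=
  UniformSpace.Completion.toComplL.comp ((TensorProduct.mkL ℂ H H').flip y)

theorem tmulRight_apply (x : H) (y : H') :
    tmulRight H y x = ((x ⊗ₜ[ℂ] y : H ⊗[ℂ] H') : HTensor H H') := rfl

theorem tensorId_tmul (u : H →L[ℂ] H) (x : H) (y : H') :
    tensorId H' u ((x ⊗ₜ[ℂ] y : H ⊗[ℂ] H') : HTensor H H') =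
      ((u x ⊗ₜ[ℂ] y : H ⊗[ℂ] H') : HTensor H H') := by
  rw [tensorId]
  simp

/-- Bounded linear maps on the Hilbert space tensor product agree if they do on pure tensors. -/
theorem clm_ext {F : Type*} [NormedAddCommGroup F] [NormedSpace ℂ F]
    {f g : HTensor H H' →L[ℂ] F}
    (h : ∀ (x : H) (y : H'), f ((x ⊗ₜ[ℂ] y : H ⊗[ℂ] H') : HTensor H H') =
      g ((x ⊗ₜ[ℂ] y : H ⊗[ℂ] H') : HTensor H H')) : f = g := by
  ext z
  induction z using UniformSpace.Completion.induction_on with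
  | hp => exact isClosed_eq f.continuous g.continuous
  | ih z =>
    induction z using TensorProduct.induction_on with
    | zero => simp only [UniformSpace.Completion.coe_zero, map_zero]
    | tmul x y => exact h x y
    | add a b ha hb => simp only [UniformSpace.Completion.coe_add, map_add, ha, hb]

/-- The product orthonormal basis of the Hilbert space tensor product. -/
theorem exists_prodBasis {ι κ : Type*} (e : HilbertBasis ι ℂ H) (e' : HilbertBasis κ ℂ H') :
    ∃ b : HilbertBasis (ι × κ) ℂ (HTensor H H'), ∀ p,
      b p = tmulRight H (e' p.2) (e p.1) := by
  have hon : Orthonormal ℂ fun p : ι × κ => tmulRight H (e' p.2) (e p.1) := by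
    have h := (e.orthonormal.tmul e'.orthonormal).comp_linearIsometry
      (UniformSpace.Completion.toComplₗᵢ (𝕜 := ℂ) (E := H ⊗[ℂ] H'))
    exact h
  refine ⟨HilbertBasis.mkOfOrthogonalEqBot hon ?_, fun p => by
    rw [HilbertBasis.coe_mkOfOrthogonalEqBot]⟩
  rw [Submodule.eq_bot_iff]
  intro z hz
  have h0 : ∀ p : ι × κ, ⟪z, tmulRight H (e' p.2) (e p.1)⟫_ℂ = 0 := fun p =>
    (Submodule.mem_orthogonal' _ z).1 hz _ (Submodule.subset_span ⟨p, rfl⟩)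
  have h1 : ∀ (x : H) (k : κ), ⟪z, tmulRight H (e' k) x⟫_ℂ = 0 := by
    intro x k
    have hs := ((innerSL ℂ z).comp (tmulRight H (e' k))).hasSum (e.hasSum_repr x)
    refine hs.unique ?_
    convert hasSum_zero using 2 with i
    have := h0 (i, k)
    simp only [ContinuousLinearMap.comp_apply, map_smul, innerSL_apply_apply,
      this, smul_zero]
  have h2 : ∀ (x : H) (y : H'), ⟪z, ((x ⊗ₜ[ℂ] y : H ⊗[ℂ] H') : HTensor H H')⟫_ℂ = 0 := by
    intro x y
    have hs := ((innerSL ℂ z).comp (UniformSpace.Completion.toComplL.comp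
      (TensorProduct.mkL ℂ H H' x))).hasSum (e'.hasSum_repr y)
    refine hs.unique ?_
    convert hasSum_zero using 2 with k
    have := h1 x k
    rw [tmulRight_apply] at this
    simp [this]
  have h3 : innerSL ℂ z = 0 := clm_ext fun x y => by simpa using h2 x y
  have h4 : ⟪z, z⟫_ℂ = 0 := by
    have := congrArg (fun f => f z) h3
    simpa using this
  exact inner_self_eq_zero.1 h4

theorem existsUnique_partialTrace (ω : QState (HTensor H H')) :
    ∃! τ : QState H, IsPartialTrace ω τ := by
  obtain ⟨v, hv, hω⟩ := exists_decomp ω.isPositive ω.isTraceClass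
  let e := hilbBasis H
  let e' := hilbBasis H'
  obtain ⟨b, hb⟩ := exists_prodBasis e e'
  let V : basisIndex H' → HTensor H H' →L[ℂ] H := fun k =>
    ContinuousLinearMap.adjoint (tmulRight H (e' k))
  have hV : ∀ k z i, ⟪e i, V k z⟫_ℂ = ⟪b (i, k), z⟫_ℂ := fun k z i => by
    rw [hb, ContinuousLinearMap.adjoint_inner_right]
  have hVu : ∀ k (u : H →L[ℂ] H) z, V k (tensorId H' u z) = u (V k z) := by
    intro k u z
    have hVt : ∀ (x : H) (y : H'), V k ((x ⊗ₜ[ℂ] y : H ⊗[ℂ] H') : HTensor H H') =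
        ⟪e' k, y⟫_ℂ • x := by
      intro x y
      refine ext_inner_left ℂ fun w => ?_
      rw [ContinuousLinearMap.adjoint_inner_right, tmulRight_apply,
        UniformSpace.Completion.inner_coe, TensorProduct.inner_tmul, inner_smul_right, mul_comm]
    have h : (V k).comp (tensorId H' u) = u.comp (V k) := clm_ext fun x y => by
      simp only [ContinuousLinearMap.comp_apply, tensorId_tmul, hVt, map_smul]
    exact congrArg (fun f => f z) h
  have hVin : ∀ z w, HasSum (fun k => ⟪V k z, V k w⟫_ℂ) ⟪z, w⟫_ℂ := by
    intro z w
    have h := (Equiv.prodComm (basisIndex H') (basisIndex H)).hasSum_iff.2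
      (b.hasSum_inner_mul_inner z w)
    refine h.prod_fiberwise fun k => ?_
    convert e.hasSum_inner_mul_inner (V k z) (V k w) using 2 with i
    rw [hV, ← inner_conj_symm (V k z), hV, inner_conj_symm]
    rfl
  have hVn : ∀ z, HasSum (fun k => ‖V k z‖ ^ 2) (‖z‖ ^ 2) := by
    intro z
    convert Complex.hasSum_re (hVin z z) using 1
    · funext k
      exact (re_inner_self_eq _).symm
    · exact (re_inner_self_eq _).symm
  let w : basisIndex (HTensor H H') × basisIndex H' → H := fun p => V p.2 (v p.1)
  have hw : Summable fun p => ‖w p‖ ^ 2 := by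
    rw [summable_prod_of_nonneg (fun p => by positivity)]
    refine ⟨fun i => (hVn (v i)).summable, ?_⟩
    simpa only [w, fun i => (hVn (v i)).tsum_eq] using hv
  obtain ⟨T, hTpos, hTtc, hT⟩ := exists_of_decomp w hw
  have key : ∀ u : H →L[ℂ] H, opTrace (u * T) = opTrace (tensorId H' u * ω.op) := by
    intro u
    rw [trace_mul_of_decomp w hw T hT, trace_mul_of_decomp v hv _ hω]
    have hs := (hasSum_inner_of_decomp w hw T hT u (hilbBasis H)).1
    have h := hs.hasSum.prod_fiberwise (g := fun i => ⟪v i, tensorId H' u (v i)⟫_ℂ) fun i => by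
      simpa only [w, hVu] using hVin (v i) (tensorId H' u (v i))
    exact h.tsum_eq.symm
  have h1 : tensorId H' (1 : H →L[ℂ] H) = 1 := clm_ext fun x y => by
    rw [tensorId_tmul]
    rfl
  refine ⟨⟨T, hTpos, hTtc, ?_⟩, key, fun τ hτ => ?_⟩
  · have := key 1
    rwa [h1, one_mul, one_mul, ω.trace_eq_one] at this
  · have hop : τ.op = T := by
      ext x
      refine ext_inner_left ℂ fun y => ?_
      have hr : ∀ A : H →L[ℂ] H,
          opTrace (InnerProductSpace.rankOne ℂ x y * A) = ⟪y, A x⟫_ℂ := by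
        intro A
        have h := (hilbBasis H).tsum_inner_mul_inner (ContinuousLinearMap.adjoint A y) x
        rw [ContinuousLinearMap.adjoint_inner_left] at h
        rw [opTrace, ← h]
        refine tsum_congr fun i => ?_
        rw [ContinuousLinearMap.adjoint_inner_left]
        simp
      rw [← hr, ← hr, hτ, key]
    cases τ
    cases hop
    rfl

/-- The partial trace of a state over `H'`: the unique state `τ` on `H` such that
`tr (u τ) = tr ((u ⊗ I) ω)` for all bounded `u`. -/
def partialTrace (ω : QState (HTensor H H')) : QState H := (existsUnique_partialTrace ω).choose

theorem partialTrace_spec (ω : QState (HTensor H H')) : IsPartialTrace ω (partialTrace ω) :=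
  (existsUnique_partialTrace ω).choose_spec.1

end PartialTrace

end

end QModel

open QModel

namespace QModel

set_option linter.unusedSectionVars false

/-! ### Self-adjoint trace-class operators: linearity, Hölder bound and trace-norm duality -/

section TraceClass

variable {H : Type*} [NormedAddCommGroup H] [InnerProductSpace ℂ H] [CompleteSpace H]

/-! The partial trace is dual to the ampliation `u ↦ u ⊗ I`, and both parts of the result come from
two properties of this map. It is a contraction in operator norm, so by duality the partial trace is
a contraction in trace norm. It is also an isometry from the observables weighted by `tr' ω` into
those weighted by `ω`, because `(u ⊗ I)² = u² ⊗ I`.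

The first property shows that if `D` is the derivative of the original model, its partial trace `E`
is the derivative of the reduced one (`HasTraceDeriv.partialTrace`). The second turns `|tr (u E)| =
|tr ((u ⊗ I) D)| ≤ C ‖u ⊗ I‖` into the regularity bound with the same `C`. Scores come from Riesz
representation. They satisfy `⟨u, S'⟩ = ⟨u ⊗ I, S⟩ ≤ ‖u‖ ‖S‖` on observables, hence by density on
all of `L2`, and testing on `S'` itself gives `‖S'‖ ≤ ‖S‖`.

The trace-class theory is needed only for self-adjoint operators. The Jordan decomposition `T = T⁺ -
T⁻` reduces it to positive operators `∑ |vᵢ⟩⟨vᵢ|`, and the sign of `T` yields the duality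
(`exists_traceNorm_eq_opTrace`). -/

theorem hasSum_opTrace_mul_of_isPositive {P : H →L[ℂ] H} (hP : P.IsPositive)
    (hP' : IsTraceClass P) (A : H →L[ℂ] H) :
    HasSum (fun i => ⟪hilbBasis H i, (A * P) (hilbBasis H i)⟫_ℂ) (opTrace (A * P)) := by
  obtain ⟨v, hv, hT⟩ := exists_decomp hP hP'
  exact (hasSum_inner_of_decomp v hv _ hT A (hilbBasis H)).2.summable.hasSum

/-- For a positive operator the trace norm is the trace, as soon as the latter converges. -/
theorem traceNorm_eq_ofReal_of_hasSum {P : H →L[ℂ] H} (hP : P.IsPositive) {c : ℂ}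
    (h : HasSum (fun i => ⟪hilbBasis H i, P (hilbBasis H i)⟫_ℂ) c) :
    traceNorm P = ENNReal.ofReal c.re := by
  rw [traceNorm_of_isPositive hP]
  have h' := Complex.hasSum_re h
  rw [← ENNReal.ofReal_tsum_of_nonneg _ h'.summable, h'.tsum_eq]
  exact fun i => hP.re_inner_nonneg_right _

theorem opTrace_re_nonneg {P : H →L[ℂ] H} (hP : P.IsPositive) (hP' : IsTraceClass P) :
    0 ≤ (opTrace P).re := by
  have h := Complex.hasSum_re (hasSum_opTrace_mul_of_isPositive hP hP' 1)
  rw [one_mul] at h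
  exact h.nonneg fun i => hP.re_inner_nonneg_right _

theorem traceNorm_toReal_of_isPositive {P : H →L[ℂ] H} (hP : P.IsPositive)
    (hP' : IsTraceClass P) : (traceNorm P).toReal = (opTrace P).re := by
  have h := hasSum_opTrace_mul_of_isPositive hP hP' 1
  rw [one_mul] at h
  rw [traceNorm_eq_ofReal_of_hasSum hP h, ENNReal.toReal_ofReal (opTrace_re_nonneg hP hP')]

theorem opTrace_eq_ofReal_of_isPositive {P : H →L[ℂ] H} (hP : P.IsPositive)
    (hP' : IsTraceClass P) : opTrace P = ((traceNorm P).toReal : ℂ) := by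
  rw [traceNorm_toReal_of_isPositive hP hP']
  refine Complex.ext (by simp) ?_
  rw [Complex.ofReal_im]
  have h := hasSum_opTrace_mul_of_isPositive hP hP' 1
  rw [one_mul] at h
  refine (Complex.hasSum_im h).unique ?_
  convert hasSum_zero using 2 with i
  have := hP.inner_nonneg_right (hilbBasis H i)
  exact (Complex.nonneg_iff.1 this).2.symm

/-- With `P = ∑ |vᵢ⟩⟨vᵢ|`, the two traces are `∑ ⟨vᵢ, A vᵢ⟩` and `∑ ‖vᵢ‖²`, which Cauchy–Schwarz
compares term by term. -/
theorem norm_opTrace_mul_le_of_isPositive {P : H →L[ℂ] H} (hP : P.IsPositive)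
    (hP' : IsTraceClass P) (A : H →L[ℂ] H) :
    ‖opTrace (A * P)‖ ≤ ‖A‖ * (traceNorm P).toReal := by
  obtain ⟨v, hv, hT⟩ := exists_decomp hP hP'
  have h1 : opTrace P = ((∑' i, ‖v i‖ ^ 2 : ℝ) : ℂ) := by
    have := trace_mul_of_decomp v hv P hT 1
    rw [one_mul] at this
    rw [this, Complex.ofReal_tsum]
    exact tsum_congr fun i => by simp
  rw [traceNorm_toReal_of_isPositive hP hP', h1, Complex.ofReal_re,
    trace_mul_of_decomp v hv _ hT, ← tsum_mul_left]
  refine tsum_of_norm_bounded (hv.mul_left ‖A‖).hasSum fun i => ?_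
  calc ‖⟪v i, A (v i)⟫_ℂ‖ ≤ ‖v i‖ * ‖A (v i)‖ := norm_inner_le_norm _ _
    _ ≤ ‖v i‖ * (‖A‖ * ‖v i‖) := by gcongr; exact A.le_opNorm _
    _ = ‖A‖ * ‖v i‖ ^ 2 := by ring

theorem opTrace_mul_im_of_isPositive {P : H →L[ℂ] H} (hP : P.IsPositive)
    (hP' : IsTraceClass P) {A : H →L[ℂ] H} (hA : IsSelfAdjoint A) :
    (opTrace (A * P)).im = 0 := by
  obtain ⟨v, hv, hT⟩ := exists_decomp hP hP'
  have hs := (hasSum_inner_of_decomp v hv _ hT A (hilbBasis H)).1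
  rw [trace_mul_of_decomp v hv _ hT]
  refine (Complex.hasSum_im hs.hasSum).unique ?_
  convert hasSum_zero using 2 with i
  rw [← Complex.conj_eq_iff_im, inner_conj_symm]
  exact hA.isSymmetric (v i) (v i)

theorem isSelfAdjoint_real_smul {T : H →L[ℂ] H} (hT : IsSelfAdjoint T) (r : ℝ) :
    IsSelfAdjoint (r • T) := by
  rw [ContinuousLinearMap.isSelfAdjoint_iff_isSymmetric] at hT ⊢
  intro x y
  have h := hT x y
  simp only [ContinuousLinearMap.coe_coe, smul_apply] at h ⊢
  rw [inner_smul_left_eq_smul, inner_smul_right_eq_smul, h]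

theorem isTraceClass_smul_of_isPositive {P : H →L[ℂ] H} (hP : P.IsPositive)
    (hP' : IsTraceClass P) {r : ℝ} (hr : 0 ≤ r) :
    (r • P).IsPositive ∧ IsTraceClass (r • P) ∧ opTrace (r • P) = r * opTrace P := by
  have hpos : (r • P).IsPositive := by
    rw [← ContinuousLinearMap.nonneg_iff_isPositive] at hP ⊢
    exact smul_nonneg hr hP
  have h := (hasSum_opTrace_mul_of_isPositive hP hP' 1).mul_left (r : ℂ)
  rw [one_mul] at h
  have h' : HasSum (fun i => ⟪hilbBasis H i, (r • P) (hilbBasis H i)⟫_ℂ) (r * opTrace P) := by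
    refine h.congr_fun fun i => ?_
    rw [smul_apply, inner_smul_right_eq_smul, Complex.real_smul]
  refine ⟨hpos, ?_, h'.tsum_eq⟩
  rw [IsTraceClass, traceNorm_eq_ofReal_of_hasSum hpos h']
  exact ENNReal.ofReal_lt_top

theorem isTraceClass_add_of_isPositive {P Q : H →L[ℂ] H} (hP : P.IsPositive)
    (hP' : IsTraceClass P) (hQ : Q.IsPositive) (hQ' : IsTraceClass Q) :
    IsTraceClass (P + Q) := by
  have h := (hasSum_opTrace_mul_of_isPositive hP hP' 1).add
    (hasSum_opTrace_mul_of_isPositive hQ hQ' 1)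
  rw [IsTraceClass, traceNorm_eq_ofReal_of_hasSum (hP.add hQ)
    (c := opTrace (1 * P) + opTrace (1 * Q))]
  · exact ENNReal.ofReal_lt_top
  · refine h.congr_fun fun i => ?_
    rw [one_mul, one_mul, add_apply, inner_add_right]

/-- The Jordan decomposition of a self-adjoint trace-class operator. -/
theorem exists_isPositive_sub {T : H →L[ℂ] H} (hT : IsSelfAdjoint T) (hT' : IsTraceClass T) :
    ∃ P N : H →L[ℂ] H, P.IsPositive ∧ IsTraceClass P ∧ N.IsPositive ∧ IsTraceClass N ∧
      T = P - N ∧ traceNorm T = traceNorm P + traceNorm N := by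
  have hP : (T⁺).IsPositive :=
    (ContinuousLinearMap.nonneg_iff_isPositive _).1 (CFC.posPart_nonneg T)
  have hN : (T⁻).IsPositive :=
    (ContinuousLinearMap.nonneg_iff_isPositive _).1 (CFC.negPart_nonneg T)
  -- `|T| = T⁺ + T⁻`, so the nonnegative diagonal entries add exactly.
  have key : traceNorm T = traceNorm T⁺ + traceNorm T⁻ := by
    rw [traceNorm_of_isPositive hP, traceNorm_of_isPositive hN, traceNorm, ← ENNReal.tsum_add,
      ← CFC.posPart_add_negPart T hT]
    refine tsum_congr fun i => ?_
    rw [add_apply, inner_add_right, Complex.add_re]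
    exact ENNReal.ofReal_add (hP.re_inner_nonneg_right _) (hN.re_inner_nonneg_right _)
  have hlt : traceNorm T⁺ + traceNorm T⁻ < ∞ := key ▸ hT'
  rw [ENNReal.add_lt_top] at hlt
  exact ⟨T⁺, T⁻, hP, hlt.1, hN, hlt.2, (CFC.posPart_sub_negPart T hT).symm, key⟩

/-- A self-adjoint operator `T` has a sign: a contraction `s` with `s T = |T|`. -/
theorem exists_sign_mul_eq_abs {T : H →L[ℂ] H} (hT : IsSelfAdjoint T) :
    ∃ s : H →L[ℂ] H, ‖s‖ ≤ 1 ∧ s * T = CFC.abs T := by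
  -- The sign is the reflection across the closed range of `T⁺`: it fixes `T⁺ x` and negates `T⁻ x`,
  -- which is orthogonal to that range because `T⁻ T⁺ = 0`.
  let K : Submodule ℂ H := (LinearMap.range (T⁺ : H →L[ℂ] H).toLinearMap).topologicalClosure
  have hK : IsClosed (K : Set H) := Submodule.isClosed_topologicalClosure _
  have : CompleteSpace K := hK.completeSpace_coe
  refine ⟨(K.reflection.toLinearIsometry).toContinuousLinearMap,
    LinearIsometry.norm_toContinuousLinearMap_le _, ?_⟩
  have hN : (T⁻).IsPositive :=
    (ContinuousLinearMap.nonneg_iff_isPositive _).1 (CFC.negPart_nonneg T)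
  ext x
  have h1 : T⁺ x ∈ K := Submodule.le_topologicalClosure _ ⟨x, rfl⟩
  have h2 : T⁻ x ∈ Kᗮ := by
    rw [Submodule.orthogonal_closure, Submodule.mem_orthogonal]
    rintro _ ⟨y, rfl⟩
    have h3 : T⁻ (T⁺ y) = 0 := congrArg (fun f : H →L[ℂ] H => f y) (CFC.negPart_mul_posPart T)
    have h4 := hN.isSymmetric (T⁺ y) x
    simp only [ContinuousLinearMap.coe_coe] at h4 ⊢
    rw [← h4, h3, inner_zero_left]
  rw [← CFC.posPart_add_negPart T hT]
  conv_lhs => rw [← CFC.posPart_sub_negPart T hT]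
  change K.reflection (T⁺ x - T⁻ x) = T⁺ x + T⁻ x
  rw [map_sub, Submodule.reflection_mem_subspace_eq_self h1,
    Submodule.reflection_mem_subspace_orthogonalComplement_eq_neg h2, sub_neg_eq_add]

/-- The operator inequality `|P - N| ≤ P + N` can fail, so the diagonals cannot be compared
directly. Instead `|P - N| = s P - s N` with `s` the sign of `P - N`, and both diagonal series on
the right converge. -/
theorem isTraceClass_sub_of_isPositive {P N : H →L[ℂ] H} (hP : P.IsPositive)
    (hP' : IsTraceClass P) (hN : N.IsPositive) (hN' : IsTraceClass N) :
    IsTraceClass (P - N) := by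
  obtain ⟨s, -, hs⟩ := exists_sign_mul_eq_abs (hP.isSelfAdjoint.sub hN.isSelfAdjoint)
  have h := (hasSum_opTrace_mul_of_isPositive hP hP' s).sub
    (hasSum_opTrace_mul_of_isPositive hN hN' s)
  have habs := (ContinuousLinearMap.nonneg_iff_isPositive _).1 (CFC.abs_nonneg (P - N))
  have h2 : IsTraceClass (CFC.abs (P - N)) := by
    rw [IsTraceClass, traceNorm_eq_ofReal_of_hasSum habs (c := opTrace (s * P) - opTrace (s * N))]
    · exact ENNReal.ofReal_lt_top
    · refine h.congr_fun fun i => ?_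
      rw [← hs, mul_sub, sub_apply, inner_sub_right]
  rwa [IsTraceClass, traceNorm_of_isPositive habs] at h2

theorem IsTraceClass.sub {S T : H →L[ℂ] H} (hS : IsSelfAdjoint S) (hS' : IsTraceClass S)
    (hT : IsSelfAdjoint T) (hT' : IsTraceClass T) : IsTraceClass (S - T) := by
  obtain ⟨P, N, hP, hP', hN, hN', rfl, -⟩ := exists_isPositive_sub hS hS'
  obtain ⟨Q, M, hQ, hQ', hM, hM', rfl, -⟩ := exists_isPositive_sub hT hT'
  rw [show P - N - (Q - M) = (P + M) - (Q + N) by abel]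
  exact isTraceClass_sub_of_isPositive (hP.add hM) (isTraceClass_add_of_isPositive hP hP' hM hM')
    (hQ.add hN) (isTraceClass_add_of_isPositive hQ hQ' hN hN')

theorem IsTraceClass.real_smul {T : H →L[ℂ] H} (hT : IsSelfAdjoint T) (hT' : IsTraceClass T)
    (r : ℝ) : IsTraceClass (r • T) := by
  obtain ⟨P, N, hP, hP', hN, hN', rfl, -⟩ := exists_isPositive_sub hT hT'
  rcases le_total 0 r with hr | hr
  · obtain ⟨h1, h2, -⟩ := isTraceClass_smul_of_isPositive hP hP' hr
    obtain ⟨h3, h4, -⟩ := isTraceClass_smul_of_isPositive hN hN' hr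
    rw [smul_sub]
    exact isTraceClass_sub_of_isPositive h1 h2 h3 h4
  · obtain ⟨h1, h2, -⟩ := isTraceClass_smul_of_isPositive hP hP' (neg_nonneg.2 hr)
    obtain ⟨h3, h4, -⟩ := isTraceClass_smul_of_isPositive hN hN' (neg_nonneg.2 hr)
    rw [show r • (P - N) = (-r) • N - (-r) • P by simp only [smul_sub, neg_smul]; abel]
    exact isTraceClass_sub_of_isPositive h3 h4 h1 h2

theorem hasSum_opTrace_mul {T : H →L[ℂ] H} (hT : IsSelfAdjoint T) (hT' : IsTraceClass T)
    (A : H →L[ℂ] H) :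
    HasSum (fun i => ⟪hilbBasis H i, (A * T) (hilbBasis H i)⟫_ℂ) (opTrace (A * T)) := by
  obtain ⟨P, N, hP, hP', hN, hN', rfl, -⟩ := exists_isPositive_sub hT hT'
  have h := (hasSum_opTrace_mul_of_isPositive hP hP' A).sub
    (hasSum_opTrace_mul_of_isPositive hN hN' A)
  refine Summable.hasSum ⟨_, h.congr_fun fun i => ?_⟩
  rw [mul_sub, sub_apply, inner_sub_right]

theorem opTrace_mul_sub {S T : H →L[ℂ] H} (hS : IsSelfAdjoint S) (hS' : IsTraceClass S)
    (hT : IsSelfAdjoint T) (hT' : IsTraceClass T) (A : H →L[ℂ] H) :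
    opTrace (A * (S - T)) = opTrace (A * S) - opTrace (A * T) := by
  refine HasSum.tsum_eq ?_
  refine ((hasSum_opTrace_mul hS hS' A).sub (hasSum_opTrace_mul hT hT' A)).congr_fun fun i => ?_
  rw [mul_sub, sub_apply, inner_sub_right]

theorem opTrace_add_mul {T : H →L[ℂ] H} (hT : IsSelfAdjoint T) (hT' : IsTraceClass T)
    (A B : H →L[ℂ] H) : opTrace ((A + B) * T) = opTrace (A * T) + opTrace (B * T) := by
  refine HasSum.tsum_eq ?_
  refine ((hasSum_opTrace_mul hT hT' A).add (hasSum_opTrace_mul hT hT' B)).congr_fun fun i => ?_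
  rw [add_mul, add_apply, inner_add_right]

theorem opTrace_mul_real_smul (A T : H →L[ℂ] H) (r : ℝ) :
    opTrace (A * (r • T)) = r * opTrace (A * T) := by
  rw [← trace_smul, mul_smul_comm]
  congr 1

theorem opTrace_mul_im {T : H →L[ℂ] H} (hT : IsSelfAdjoint T) (hT' : IsTraceClass T)
    {A : H →L[ℂ] H} (hA : IsSelfAdjoint A) : (opTrace (A * T)).im = 0 := by
  obtain ⟨P, N, hP, hP', hN, hN', rfl, -⟩ := exists_isPositive_sub hT hT'
  rw [opTrace_mul_sub hP.isSelfAdjoint hP' hN.isSelfAdjoint hN', Complex.sub_im,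
    opTrace_mul_im_of_isPositive hP hP' hA, opTrace_mul_im_of_isPositive hN hN' hA, sub_zero]

/-- The constant is 1 because the trace norm is additive over the Jordan decomposition. -/
theorem norm_opTrace_mul_le {T : H →L[ℂ] H} (hT : IsSelfAdjoint T) (hT' : IsTraceClass T)
    (A : H →L[ℂ] H) : ‖opTrace (A * T)‖ ≤ ‖A‖ * (traceNorm T).toReal := by
  obtain ⟨P, N, hP, hP', hN, hN', rfl, h⟩ := exists_isPositive_sub hT hT'
  rw [opTrace_mul_sub hP.isSelfAdjoint hP' hN.isSelfAdjoint hN', h,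
    ENNReal.toReal_add hP'.ne hN'.ne, mul_add]
  exact (norm_sub_le _ _).trans (add_le_add (norm_opTrace_mul_le_of_isPositive hP hP' A)
    (norm_opTrace_mul_le_of_isPositive hN hN' A))

theorem opTrace_rankOne_mul (x y : H) (A : H →L[ℂ] H) :
    opTrace (InnerProductSpace.rankOne ℂ x y * A) = ⟪y, A x⟫_ℂ := by
  have h := (hilbBasis H).tsum_inner_mul_inner (ContinuousLinearMap.adjoint A y) x
  rw [ContinuousLinearMap.adjoint_inner_left] at h
  rw [opTrace, ← h]
  refine tsum_congr fun i => ?_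
  rw [ContinuousLinearMap.adjoint_inner_left]
  simp

/-- Pairing `T` with rank-one operators of norm 1 recovers its matrix coefficients between unit
vectors. This makes the trace norm definite, which is what uniqueness of derivatives rests on. -/
theorem norm_le_traceNorm {T : H →L[ℂ] H} (hT : IsSelfAdjoint T) (hT' : IsTraceClass T) :
    ‖T‖ ≤ (traceNorm T).toReal := by
  refine ContinuousLinearMap.opNorm_le_of_re_inner_le ENNReal.toReal_nonneg fun x y hx hy => ?_
  have h := norm_opTrace_mul_le hT hT' (InnerProductSpace.rankOne ℂ x y)
  rw [opTrace_rankOne_mul, InnerProductSpace.norm_rankOne, hx, hy, one_mul, one_mul,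
    norm_inner_symm] at h
  exact (RCLike.re_le_norm _).trans h

/-- The trace norm of `T` is attained as `tr (s T)` for a contraction `s`. -/
theorem exists_traceNorm_eq_opTrace {T : H →L[ℂ] H} (hT : IsSelfAdjoint T)
    (hT' : IsTraceClass T) :
    ∃ s : H →L[ℂ] H, ‖s‖ ≤ 1 ∧ opTrace (s * T) = ((traceNorm T).toReal : ℂ) := by
  obtain ⟨s, hs, hsT⟩ := exists_sign_mul_eq_abs hT
  have habs := (ContinuousLinearMap.nonneg_iff_isPositive _).1 (CFC.abs_nonneg T)
  have h : traceNorm (CFC.abs T) = traceNorm T := by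
    rw [traceNorm_of_isPositive habs, traceNorm]
  refine ⟨s, hs, ?_⟩
  rw [hsT, opTrace_eq_ofReal_of_isPositive habs, h]
  rwa [IsTraceClass, h]

end TraceClass

/-! ### Partial trace of self-adjoint operators and the ampliation `u ↦ u ⊗ I` -/

section PartialTrace

variable {H H' : Type*} [NormedAddCommGroup H] [InnerProductSpace ℂ H] [CompleteSpace H]
  [NormedAddCommGroup H'] [InnerProductSpace ℂ H'] [CompleteSpace H']

theorem norm_tensorId_le (u : H →L[ℂ] H) : ‖tensorId H' u‖ ≤ ‖u‖ := by
  refine ContinuousLinearMap.opNorm_le_bound _ (norm_nonneg _) fun z => ?_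
  induction z using UniformSpace.Completion.induction_on with
  | hp => exact isClosed_le (by fun_prop) (by fun_prop)
  | ih z =>
    rw [tensorId, ContinuousLinearMap.completion_apply_coe, UniformSpace.Completion.norm_coe,
      UniformSpace.Completion.norm_coe]
    exact ContinuousLinearMap.le_of_opNorm_le _ (ContinuousLinearMap.norm_rTensor_le _ u) z

theorem tensorId_mul (u v : H →L[ℂ] H) :
    tensorId H' (u * v) = tensorId H' u * tensorId H' v :=
  clm_ext fun x y => by
    simp only [tensorId_tmul, mul_apply_eq_comp]

theorem isSelfAdjoint_tensorId {u : H →L[ℂ] H} (hu : IsSelfAdjoint u) :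
    IsSelfAdjoint (tensorId H' u) := by
  rw [ContinuousLinearMap.isSelfAdjoint_iff']
  refine clm_ext fun x y => ?_
  refine ext_inner_right ℂ fun w => ?_
  rw [ContinuousLinearMap.adjoint_inner_left]
  -- Both sides are values at `w` of continuous linear functionals, so the second argument may also
  -- be taken to be a pure tensor.
  refine congrArg (fun f : HTensor H H' →L[ℂ] ℂ => f w) (?_ :
    (innerSL ℂ ((x ⊗ₜ[ℂ] y : H ⊗[ℂ] H') : HTensor H H')).comp (tensorId H' u) =
      innerSL ℂ (tensorId H' u ((x ⊗ₜ[ℂ] y : H ⊗[ℂ] H') : HTensor H H')))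
  refine clm_ext fun x' y' => ?_
  simp only [ContinuousLinearMap.comp_apply, tensorId_tmul, innerSL_apply_apply,
    UniformSpace.Completion.inner_coe, TensorProduct.inner_tmul]
  congr 1
  exact (hu.isSymmetric x x').symm

/-- Partial trace of a positive trace-class operator. -/
theorem exists_partialTrace_of_isPositive {P : HTensor H H' →L[ℂ] HTensor H H'}
    (hP : P.IsPositive) (hP' : IsTraceClass P) :
    ∃ Q : H →L[ℂ] H, Q.IsPositive ∧ IsTraceClass Q ∧
      ∀ u, opTrace (u * Q) = opTrace (tensorId H' u * P) := by
  set t : ℝ := (traceNorm P).toReal with ht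
  have htr := opTrace_eq_ofReal_of_isPositive hP hP'
  have ht0 : 0 ≤ t := ENNReal.toReal_nonneg
  -- `partialTrace` is available for states only, so `P` is normalised by its trace `t` and the
  -- result scaled back; `t = 0` forces `P = 0`.
  rcases eq_or_ne t 0 with h0 | h0
  · have hP0 : P = 0 := by
      have h := norm_le_traceNorm hP.isSelfAdjoint hP'
      exact norm_le_zero_iff.1 (h.trans_eq h0)
    refine ⟨0, ContinuousLinearMap.isPositive_zero, ?_, fun u => ?_⟩
    · simp [IsTraceClass, traceNorm]
    · simp [hP0, opTrace]
  · obtain ⟨h1, h2, h3⟩ := isTraceClass_smul_of_isPositive hP hP' (inv_nonneg.2 ht0)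
    let ρ : QState (HTensor H H') := ⟨t⁻¹ • P, h1, h2, by
      rw [h3, htr, ← Complex.ofReal_mul, inv_mul_cancel₀ h0, Complex.ofReal_one]⟩
    obtain ⟨h4, h5, -⟩ := isTraceClass_smul_of_isPositive (partialTrace ρ).isPositive
      (partialTrace ρ).isTraceClass ht0
    refine ⟨t • (partialTrace ρ).op, h4, h5, fun u => ?_⟩
    rw [opTrace_mul_real_smul, partialTrace_spec ρ u, opTrace_mul_real_smul, ← mul_assoc,
      ← Complex.ofReal_mul, mul_inv_cancel₀ h0, Complex.ofReal_one, one_mul]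

/-- Partial trace of a self-adjoint trace-class operator. -/
theorem exists_partialTrace_of_isSelfAdjoint {T : HTensor H H' →L[ℂ] HTensor H H'}
    (hT : IsSelfAdjoint T) (hT' : IsTraceClass T) :
    ∃ Q : H →L[ℂ] H, IsSelfAdjoint Q ∧ IsTraceClass Q ∧
      ∀ u, opTrace (u * Q) = opTrace (tensorId H' u * T) := by
  obtain ⟨P, N, hP, hP', hN, hN', rfl, -⟩ := exists_isPositive_sub hT hT'
  obtain ⟨Q, hQ, hQ', hQP⟩ := exists_partialTrace_of_isPositive hP hP'
  obtain ⟨M, hM, hM', hMN⟩ := exists_partialTrace_of_isPositive hN hN'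
  refine ⟨Q - M, hQ.isSelfAdjoint.sub hM.isSelfAdjoint,
    isTraceClass_sub_of_isPositive hQ hQ' hM hM', fun u => ?_⟩
  rw [opTrace_mul_sub hQ.isSelfAdjoint hQ' hM.isSelfAdjoint hM',
    opTrace_mul_sub hP.isSelfAdjoint hP' hN.isSelfAdjoint hN', hQP, hMN]

/-- The partial trace is a contraction for the trace norm. -/
theorem traceNorm_le_of_forall_opTrace_eq {T : HTensor H H' →L[ℂ] HTensor H H'}
    (hT : IsSelfAdjoint T) (hT' : IsTraceClass T) {Q : H →L[ℂ] H} (hQ : IsSelfAdjoint Q)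
    (hQ' : IsTraceClass Q) (h : ∀ u, opTrace (u * Q) = opTrace (tensorId H' u * T)) :
    traceNorm Q ≤ traceNorm T := by
  obtain ⟨s, hs, hsQ⟩ := exists_traceNorm_eq_opTrace hQ hQ'
  rw [← ENNReal.toReal_le_toReal hQ'.ne hT'.ne]
  calc (traceNorm Q).toReal = ‖opTrace (s * Q)‖ := by
        rw [hsQ, Complex.norm_real, Real.norm_of_nonneg ENNReal.toReal_nonneg]
    _ = ‖opTrace (tensorId H' s * T)‖ := by rw [h]
    _ ≤ ‖tensorId H' s‖ * (traceNorm T).toReal := norm_opTrace_mul_le hT hT' _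
    _ ≤ 1 * (traceNorm T).toReal := by
        gcongr
        exact (norm_tensorId_le s).trans hs
    _ = (traceNorm T).toReal := one_mul _

/-- The observable `u ⊗ I`, for a bounded observable `u`. -/
noncomputable def Obs.tensorId {ω : QState (HTensor H H')} (u : Obs (partialTrace ω)) : Obs ω :=
  ⟨QModel.tensorId H' u.op, isSelfAdjoint_tensorId u.isSelfAdjoint⟩

theorem Obs.norm_sq_eq {ρ : QState H} (u : Obs ρ) :
    ‖u‖ ^ 2 = (opTrace (u.op * u.op * ρ.op)).re := by
  rw [← real_inner_self_eq_norm_sq]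
  change (opTrace (jordan u.op u.op * ρ.op)).re = _
  congr 3
  rw [jordan, ← two_smul ℂ, smul_smul]
  norm_num

/-- Multiplicativity of the ampliation: `tr ((u ⊗ I)² ω) = tr ((u² ⊗ I) ω) = tr (u² tr' ω)`. -/
theorem Obs.norm_tensorId {ω : QState (HTensor H H')} (u : Obs (partialTrace ω)) :
    ‖u.tensorId‖ = ‖u‖ := by
  rw [← sq_eq_sq₀ (norm_nonneg _) (norm_nonneg _), Obs.norm_sq_eq, Obs.norm_sq_eq,
    partialTrace_spec, tensorId_mul]
  rfl

end PartialTrace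

/-! ### Uniqueness of the derivative; existence and uniqueness of the score -/

section Score

/-- The derivative is a limit along the punctured neighbourhood filter, so it is determined only if
`θ₀` is an accumulation point of `R`. -/
theorem nhdsNE_neBot_of_isOpen {R : Set ℝ} (hR : IsOpen R) (θ₀ : R) : (𝓝[≠] θ₀).NeBot := by
  rw [nhds_ne_subtype_neBot_iff, inf_of_le_left]
  · infer_instance
  · exact Filter.le_principal_iff.2 (mem_nhdsWithin_of_mem_nhds (hR.mem_nhds θ₀.2))

variable {H : Type*} [NormedAddCommGroup H] [InnerProductSpace ℂ H] [CompleteSpace H]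

theorem HasTraceDeriv.isSelfAdjoint_sub {R : Set ℝ} {σ : R → QState H} {θ₀ : R} {D : H →L[ℂ] H}
    (h : HasTraceDeriv σ θ₀ D) (θ : R) :
    IsSelfAdjoint ((σ θ).op - (σ θ₀).op - ((θ : ℝ) - (θ₀ : ℝ)) • D) :=
  ((σ θ).isPositive.isSelfAdjoint.sub (σ θ₀).isPositive.isSelfAdjoint).sub
    (isSelfAdjoint_real_smul h.1 _)

theorem HasTraceDeriv.isTraceClass_sub {R : Set ℝ} {σ : R → QState H} {θ₀ : R} {D : H →L[ℂ] H}
    (h : HasTraceDeriv σ θ₀ D) (θ : R) :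
    IsTraceClass ((σ θ).op - (σ θ₀).op - ((θ : ℝ) - (θ₀ : ℝ)) • D) :=
  IsTraceClass.sub ((σ θ).isPositive.isSelfAdjoint.sub (σ θ₀).isPositive.isSelfAdjoint)
    (isTraceClass_sub_of_isPositive (σ θ).isPositive (σ θ).isTraceClass (σ θ₀).isPositive
      (σ θ₀).isTraceClass) (isSelfAdjoint_real_smul h.1 _) (IsTraceClass.real_smul h.1 h.2.1 _)

theorem HasTraceDeriv.unique {R : Set ℝ} {σ : R → QState H} {θ₀ : R} [(𝓝[≠] θ₀).NeBot]
    {D E : H →L[ℂ] H} (hD : HasTraceDeriv σ θ₀ D) (hE : HasTraceDeriv σ θ₀ E) : D = E := by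
  have h1 := (ENNReal.tendsto_toReal ENNReal.zero_ne_top).comp hD.2.2
  have h2 := (ENNReal.tendsto_toReal ENNReal.zero_ne_top).comp hE.2.2
  have h3 := h1.add h2
  rw [ENNReal.toReal_zero, add_zero] at h3
  rw [← sub_eq_zero, ← norm_le_zero_iff]
  -- The constant `‖D - E‖` is bounded, at every `θ ≠ θ₀`, by the sum of the two remainder
  -- quotients, which tends to 0. The triangle inequality is applied in operator norm, and only then
  -- is each term bounded by its trace norm.
  refine ge_of_tendsto h3 ?_
  filter_upwards [self_mem_nhdsWithin] with θ hθ
  have hpos : 0 < |(θ : ℝ) - (θ₀ : ℝ)| :=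
    abs_pos.2 (sub_ne_zero.2 fun h => hθ (Subtype.ext h))
  simp only [Function.comp_apply, ENNReal.toReal_div, ENNReal.toReal_ofReal hpos.le]
  rw [← add_div, le_div_iff₀ hpos]
  calc ‖D - E‖ * |(θ : ℝ) - (θ₀ : ℝ)|
      = ‖((θ : ℝ) - (θ₀ : ℝ)) • (D - E)‖ := by rw [norm_smul, Real.norm_eq_abs, mul_comm]
    _ = ‖((σ θ).op - (σ θ₀).op - ((θ : ℝ) - (θ₀ : ℝ)) • E) -
          ((σ θ).op - (σ θ₀).op - ((θ : ℝ) - (θ₀ : ℝ)) • D)‖ := by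
        rw [smul_sub, sub_sub_sub_cancel_left]
    _ ≤ ‖(σ θ).op - (σ θ₀).op - ((θ : ℝ) - (θ₀ : ℝ)) • D‖ +
          ‖(σ θ).op - (σ θ₀).op - ((θ : ℝ) - (θ₀ : ℝ)) • E‖ := by
        rw [add_comm]
        exact norm_sub_le _ _
    _ ≤ _ := add_le_add (norm_le_traceNorm (hD.isSelfAdjoint_sub θ) (hD.isTraceClass_sub θ))
        (norm_le_traceNorm (hE.isSelfAdjoint_sub θ) (hE.isTraceClass_sub θ))

/-- A score represents the functional `u ↦ tr (u D)` on bounded observables. -/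
theorem IsScore.opTrace_eq_inner {R : Set ℝ} {σ : R → QState H} {θ₀ : R} [(𝓝[≠] θ₀).NeBot]
    {D : H →L[ℂ] H} (hD : HasTraceDeriv σ θ₀ D) {S : L2 (σ θ₀)} (hS : IsScore σ θ₀ S)
    (u : Obs (σ θ₀)) : opTrace (u.op * D) = ((⟪(u : L2 (σ θ₀)), S⟫_ℝ : ℝ) : ℂ) := by
  obtain ⟨E, hE, l, hl, hl'⟩ := hS
  rw [hD.unique hE, hl, hl']

theorem IsRegularAt.existsUnique_isScore {R : Set ℝ} {σ : R → QState H} {θ₀ : R}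
    [(𝓝[≠] θ₀).NeBot] (h : IsRegularAt σ θ₀) : ∃! S : L2 (σ θ₀), IsScore σ θ₀ S := by
  obtain ⟨D, hD, C, hC⟩ := h
  let f : Obs (σ θ₀) →ₗ[ℝ] ℝ :=
    -- Taking the real part loses nothing: `tr (u D)` is real for self-adjoint `u` and `D`.
    { toFun := fun u => (opTrace (u.op * D)).re
      map_add' := fun u v => by
        have : (u + v).op = u.op + v.op := rfl
        rw [this, opTrace_add_mul hD.1 hD.2.1, Complex.add_re]
      map_smul' := fun r u => by
        have : (r • u).op * D = u.op * (r • D) := by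
          rw [mul_smul_comm, ← smul_mul_assoc]
          rfl
        rw [this, opTrace_mul_real_smul, Complex.re_ofReal_mul]
        rfl }
  let g : Obs (σ θ₀) →L[ℝ] ℝ := f.mkContinuous C fun u =>
    (Complex.abs_re_le_norm _).trans (hC u)
  let l : L2 (σ θ₀) →L[ℝ] ℝ := g.extend UniformSpace.Completion.toComplL
  have hl : ∀ u : Obs (σ θ₀), l (u : L2 (σ θ₀)) = (opTrace (u.op * D)).re := fun u =>
    ContinuousLinearMap.extend_eq g UniformSpace.Completion.denseRange_coe
      (UniformSpace.Completion.isUniformInducing_coe _) u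
  refine ⟨(InnerProductSpace.toDual ℝ (L2 (σ θ₀))).symm l, ⟨D, hD, l, fun u => ?_, fun X => ?_⟩,
    fun S hS => ?_⟩
  · rw [hl]
    exact Complex.ext (by simp) (by
      rw [opTrace_mul_im hD.1 hD.2.1 u.isSelfAdjoint, Complex.ofReal_im])
  · rw [real_inner_comm, InnerProductSpace.toDual_symm_apply]
  -- The derivative is unique, so any score agrees with the Riesz vector when tested on the dense
  -- image of the observables.
  · refine ext_inner_left ℝ fun X => ?_
    rw [real_inner_comm _ X, real_inner_comm _ X, InnerProductSpace.toDual_symm_apply]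
    induction X using UniformSpace.Completion.induction_on with
    | hp => exact isClosed_eq (by fun_prop) l.continuous
    | ih u =>
      rw [hl, hS.opTrace_eq_inner hD, Complex.ofReal_re, real_inner_comm]

end Score

/-! ### Regularity and information loss under the partial trace -/

section PartialTraceModel

variable {H H' : Type*} [NormedAddCommGroup H] [InnerProductSpace ℂ H] [CompleteSpace H]
  [NormedAddCommGroup H'] [InnerProductSpace ℂ H'] [CompleteSpace H']

theorem HasTraceDeriv.partialTrace {R : Set ℝ} {ω : R → QState (HTensor H H')} {θ₀ : R}
    {D : HTensor H H' →L[ℂ] HTensor H H'} (hD : HasTraceDeriv ω θ₀ D) :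
    ∃ E : H →L[ℂ] H, HasTraceDeriv (fun θ => partialTrace (ω θ)) θ₀ E ∧
      ∀ u, opTrace (u * E) = opTrace (tensorId H' u * D) := by
  obtain ⟨E, hE, hE', hED⟩ := exists_partialTrace_of_isSelfAdjoint hD.1 hD.2.1
  refine ⟨E, ⟨hE, hE', ?_⟩, hED⟩
  -- By linearity the remainder of the reduced model is the partial trace of the original remainder,
  -- so trace-norm contraction squeezes the quotient.
  refine tendsto_of_tendsto_of_tendsto_of_le_of_le tendsto_const_nhds hD.2.2
    (fun _ => zero_le) fun θ => ENNReal.div_le_div_right ?_ _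
  have hτ : ∀ θ, IsSelfAdjoint (QModel.partialTrace (ω θ)).op := fun θ =>
    (QModel.partialTrace (ω θ)).isPositive.isSelfAdjoint
  have hω : ∀ θ, IsSelfAdjoint (ω θ).op := fun θ => (ω θ).isPositive.isSelfAdjoint
  have hτ1 := isTraceClass_sub_of_isPositive (QModel.partialTrace (ω θ)).isPositive
    (QModel.partialTrace (ω θ)).isTraceClass (QModel.partialTrace (ω θ₀)).isPositive
    (QModel.partialTrace (ω θ₀)).isTraceClass
  have hω1 := isTraceClass_sub_of_isPositive (ω θ).isPositive (ω θ).isTraceClass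
    (ω θ₀).isPositive (ω θ₀).isTraceClass
  have hEs := IsTraceClass.real_smul hE hE' ((θ : ℝ) - (θ₀ : ℝ))
  have hDs := IsTraceClass.real_smul hD.1 hD.2.1 ((θ : ℝ) - (θ₀ : ℝ))
  have hEa : IsSelfAdjoint (((θ : ℝ) - (θ₀ : ℝ)) • E) := isSelfAdjoint_real_smul hE _
  have hDa : IsSelfAdjoint (((θ : ℝ) - (θ₀ : ℝ)) • D) := isSelfAdjoint_real_smul hD.1 _
  refine traceNorm_le_of_forall_opTrace_eq (hD.isSelfAdjoint_sub θ) (hD.isTraceClass_sub θ)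
    (((hτ θ).sub (hτ θ₀)).sub hEa) (IsTraceClass.sub ((hτ θ).sub (hτ θ₀)) hτ1 hEa hEs)
    fun u => ?_
  rw [opTrace_mul_sub ((hτ θ).sub (hτ θ₀)) hτ1 hEa hEs,
    opTrace_mul_sub (hτ θ) (QModel.partialTrace (ω θ)).isTraceClass (hτ θ₀)
      (QModel.partialTrace (ω θ₀)).isTraceClass,
    opTrace_mul_sub ((hω θ).sub (hω θ₀)) hω1 hDa hDs,
    opTrace_mul_sub (hω θ) (ω θ).isTraceClass (hω θ₀) (ω θ₀).isTraceClass,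
    opTrace_mul_real_smul, opTrace_mul_real_smul, partialTrace_spec, partialTrace_spec, hED]

theorem IsRegularAt.partialTrace {R : Set ℝ} {ω : R → QState (HTensor H H')} {θ₀ : R}
    (h : IsRegularAt ω θ₀) : IsRegularAt (fun θ => partialTrace (ω θ)) θ₀ := by
  obtain ⟨D, hD, C, hC⟩ := h
  obtain ⟨E, hE, hED⟩ := hD.partialTrace
  refine ⟨E, hE, C, fun u => ?_⟩
  rw [hED, ← Obs.norm_tensorId u]
  exact hC u.tensorId

theorem IsScore.norm_partialTrace_le {R : Set ℝ} {ω : R → QState (HTensor H H')} {θ₀ : R}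
    [(𝓝[≠] θ₀).NeBot] {S : L2 (ω θ₀)} {S' : L2 (partialTrace (ω θ₀))} (hS : IsScore ω θ₀ S)
    (hS' : IsScore (fun θ => partialTrace (ω θ)) θ₀ S') : ‖S'‖ ≤ ‖S‖ := by
  obtain ⟨D, hD, -⟩ := id hS
  obtain ⟨E, hE, hED⟩ := hD.partialTrace
  -- The inequality is closed in `X`, so it suffices to prove it for observables `u`, where both
  -- sides are transported to `u ⊗ I`.
  have key : ∀ X : L2 (QModel.partialTrace (ω θ₀)), ⟪X, S'⟫_ℝ ≤ ‖X‖ * ‖S‖ := by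
    intro X
    induction X using UniformSpace.Completion.induction_on with
    | hp => exact isClosed_le (by fun_prop) (by fun_prop)
    | ih u =>
      have h1 := hS'.opTrace_eq_inner hE u
      have h2 := hS.opTrace_eq_inner hD u.tensorId
      have h3 : ⟪(u : L2 (QModel.partialTrace (ω θ₀))), S'⟫_ℝ =
          ⟪(u.tensorId : L2 (ω θ₀)), S⟫_ℝ :=
        Complex.ofReal_injective (h1.symm.trans ((hED u.op).trans h2))
      rw [h3, UniformSpace.Completion.norm_coe, ← Obs.norm_tensorId u,
        ← UniformSpace.Completion.norm_coe]
      exact real_inner_le_norm _ _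
  -- Taking `X = S'` gives `‖S'‖² ≤ ‖S'‖ ‖S‖`; cancelling a factor needs `S'` to have nonzero norm.
  have h := key S'
  rw [real_inner_self_eq_norm_mul_norm] at h
  rcases (norm_nonneg S').eq_or_lt with h0 | h0
  · exact h0 ▸ norm_nonneg S
  · exact le_of_mul_le_mul_left h h0

end PartialTraceModel

end QModel

theorem lemma3 {H H' : Type*}
    [NormedAddCommGroup H] [InnerProductSpace ℂ H] [CompleteSpace H]
    [NormedAddCommGroup H'] [InnerProductSpace ℂ H'] [CompleteSpace H']
    (R : Set ℝ) (hR : IsOpen R) (hR' : R.OrdConnected) (θ₀ : R)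
    (ω : R → QState (HTensor H H')) (hω : IsRegularAt ω θ₀) :
    IsRegularAt (fun θ => partialTrace (ω θ)) θ₀ ∧
      (∃! S : L2 (ω θ₀), IsScore ω θ₀ S) ∧
      (∃! S' : L2 (partialTrace (ω θ₀)), IsScore (fun θ => partialTrace (ω θ)) θ₀ S') ∧
      ∀ (S : L2 (ω θ₀)) (S' : L2 (partialTrace (ω θ₀))),
        IsScore ω θ₀ S → IsScore (fun θ => partialTrace (ω θ)) θ₀ S' →
          ‖S'‖ ^ 2 ≤ ‖S‖ ^ 2 := by
  have := nhdsNE_neBot_of_isOpen hR θ₀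
  refine ⟨hω.partialTrace, hω.existsUnique_isScore, hω.partialTrace.existsUnique_isScore,
    fun S S' hS hS' => ?_⟩
  gcongr
  exact hS.norm_partialTrace_le hS'
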